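/- All graphs are finite, undirected and simple. For a positive integer $t$, an interval $t$-coloring of a graph $G$ is a proper edge-coloring of $G$ with colors $1,\dots,t$ such that all colors are used and, for each vertex $v$, the set of colors of the edges incident to $v$ is an interval of integers. $G$ is interval colorable if it has an interval $t$-coloring for some positive integer $t$, and then $W(G)$ denotes the maximum number of colors in an interval coloring of $G$. For integers $a_1,\dots,a_k\ge 3$, let $T(a_1,\dots,a_k)=C_{a_1}\square C_{a_2}\square\cdots\square C_{a_k}$ be the Cartesian product of cycles, and let $Q_d$ be the hypercube of dimension $d$. 1) Let $k\ge 1$ and let $n_1,\dots,n_k$ be integers with $2\le n_1\le n_2\le\cdots\le n_k$. Then $T(2n_1,\dots,2n_k)$ is interval colorable and $$W(T(2n_1,2n_2,\dots,2n_k))\ \ge\ k+\sum_{i=1}^{k}n_i(2i-1).$$ 2) Let $k\ge 1$, $s\ge 0$, and let $m_1,\dots,m_k,n_1,\dots,n_{k+s}$ be integers with $1\le m_1\le\cdots\le m_k$ and $2\le n_1\le\cdots\le n_{k+s}$. Then $T(2n_1,\dots,2n_{k+s},2m_1+1,\dots,2m_k+1)$ is interval colorable and $$W(T(2n_1,\dots,2n_{k+s},2m_1+1,\dots,2m_k+1))\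 \ge\ s+2k^2+2\sum_{i=1}^{k}(m_i+n_i)+\sum_{j=1}^{s}n_{k+j}(4k+2j-1).$$ The bound in 1) is sharp: for every $k\ge 1$ and $n_1=\cdots=n_k=2$, the torus $T(4,\dots,4)$ ($k$ factors) is isomorphic to $Q_{2k}$, the bound in 1) is attained with equality, and $W(Q_{2k})=2k^2+k$. -/

import Mathlib

namespace IntervalColoring

variable {V : Type*}

/-- The spectrum of a vertex `v` under an edge-coloring `α`: the set of the colors of the edges
incident to `v`. -/
def vertexSpectrum (G : SimpleGraph V) (α : G.edgeSet → ℕ) (v : V) : Set ℕ :=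
  {c | ∃ e : G.edgeSet, v ∈ (e : Sym2 V) ∧ α e = c}

/-- An edge-coloring is proper if two distinct edges with a common endpoint have different
colors. -/
def IsProper (G : SimpleGraph V) (α : G.edgeSet → ℕ) : Prop :=
  ∀ (v : V) (e f : G.edgeSet), v ∈ (e : Sym2 V) → v ∈ (f : Sym2 V) → e ≠ f → α e ≠ α f

/-- An interval `t`-coloring of `G`: a proper edge-coloring with colors `1, …, t` such that all
of these colors are used and, at each vertex, the colors of the incident edges form an interval
of integers (the empty one at an isolated vertex). -/
structure IsIntervalColoring (G : SimpleGraph V) (t : ℕ) (α : G.edgeSet → ℕ) : Prop where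
  proper : IsProper G α
  range_eq : Set.range α = Set.Icc 1 t
  interval : ∀ v : V, ∃ a b : ℕ, vertexSpectrum G α v = Set.Icc a b

/-- `G` has an interval `t`-coloring. -/
def HasIntervalColoring (G : SimpleGraph V) (t : ℕ) : Prop :=
  ∃ α : G.edgeSet → ℕ, IsIntervalColoring G t α

/-- `G` is interval colorable: it has an interval `t`-coloring for some positive integer `t`. -/
def IsIntervalColorable (G : SimpleGraph V) : Prop :=
  ∃ t : ℕ, 0 < t ∧ HasIntervalColoring G t

/-- `W(G)`: the maximum number of colors in an interval coloring of `G` (see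
`isGreatest_maxColors`: for a finite interval colorable graph this maximum is attained). -/
noncomputable def maxColors (G : SimpleGraph V) : ℕ :=
  sSup {t : ℕ | HasIntervalColoring G t}

theorem bddAbove_hasIntervalColoring [Finite V] (G : SimpleGraph V) :
    BddAbove {t : ℕ | HasIntervalColoring G t} := by
  refine ⟨Nat.card G.edgeSet, ?_⟩
  rintro t ⟨α, hα⟩
  have h1 : (Set.range α).ncard = t := by
    rw [hα.range_eq, ← Finset.coe_Icc, Set.ncard_coe_finset]; simp
  rw [← h1, ← Set.image_univ, ← Set.ncard_univ]
  exact Set.ncard_image_le Set.finite_univ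

theorem isGreatest_maxColors [Finite V] (G : SimpleGraph V) (hG : IsIntervalColorable G) :
    IsGreatest {t : ℕ | HasIntervalColoring G t} (maxColors G) := by
  obtain ⟨t, -, ht⟩ := hG
  exact ⟨Nat.sSup_mem ⟨t, ht⟩ (bddAbove_hasIntervalColoring G),
    fun s hs => le_csSup (bddAbove_hasIntervalColoring G) hs⟩

/-- The Cartesian product of a family of graphs: two vertices are adjacent if they are adjacent
in one coordinate and agree in all the others. -/
def cartesianProduct {ι : Type*} {W : ι → Type*} (G : ∀ i, SimpleGraph (W i)) :
    SimpleGraph (∀ i, W i) where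
  Adj x y := ∃ i, (G i).Adj (x i) (y i) ∧ ∀ j, j ≠ i → x j = y j
  symm := ⟨fun _ _ ⟨i, hi, hij⟩ => ⟨i, hi.symm, fun j hj => (hij j hj).symm⟩⟩
  loopless := ⟨fun _ ⟨_, hi, _⟩ => hi.ne rfl⟩

/-- The product of a nonempty finite family is the iterated binary product. -/
theorem cartesianProduct_succ {k : ℕ} {W : Fin (k + 1) → Type*} (G : ∀ i, SimpleGraph (W i)) :
    Nonempty (cartesianProduct G ≃g (G 0).boxProd (cartesianProduct fun i : Fin k => G i.succ)) := by
  refine ⟨⟨(Fin.consEquiv W).symm, ?_⟩⟩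
  intro x y
  simp only [SimpleGraph.boxProd_adj, Fin.consEquiv, cartesianProduct, Equiv.coe_fn_symm_mk,
    Fin.exists_fin_succ, Fin.tail, Fin.forall_fin_succ, funext_iff]
  simp only [ne_eq, not_true_eq_false, Fin.succ_ne_zero, not_false_eq_true, true_implies,
    false_implies, true_and, (Fin.succ_ne_zero _).symm, Fin.succ_inj]
  refine or_congr Iff.rfl ⟨?_, ?_⟩
  · rintro ⟨⟨i, h1, h2⟩, h0⟩
    exact ⟨i, h1, h0, h2⟩
  · rintro ⟨i, h1, h0, h2⟩
    exact ⟨⟨i, h1, h2⟩, h0⟩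

/-- The `k`-dimensional torus `T(a₁, …, aₖ)`: the Cartesian product of the cycles `C_{aᵢ}`. -/
def torus {k : ℕ} (a : Fin k → ℕ) : SimpleGraph (∀ i : Fin k, Fin (a i)) :=
  cartesianProduct fun i => SimpleGraph.cycleGraph (a i)

/-- The hypercube `Q_d`: binary words of length `d`, adjacent if they differ in exactly one
position. -/
def hypercube (d : ℕ) : SimpleGraph (Fin d → Bool) where
  Adj x y := hammingDist x y = 1
  symm := ⟨fun x y h => by rw [hammingDist_comm]; exact h⟩
  loopless := ⟨fun x h => by simp at h⟩

end IntervalColoring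

namespace IntervalColoring

open SimpleGraph Set

/-! All graphs involved are regular, so an interval coloring is described by the least color `a v`
at each vertex, with integer colors allowed. On a connected graph no color between the extremes is
missed, since adjacent vertices have overlapping color intervals; translation then gives a genuine
interval coloring (`HasSpan.exists_hasIntervalColoring`).

The lower bounds come from one product construction, `HasSpan.boxProd_of_slots`: color the edges of
`H` so that the colors at each vertex, together with an empty slot of length `r`, form an interval.
Copies of the `r`-regular graph `G` fill the slots, and each copy of `H` is translated by `a v`, so
the spans add. For an even cycle the two colors at most vertices straddle the slot, and the cycle
contributes `n * (r + 1) + 1`. An odd cycle is first paired with an even one, a product colored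
explicitly with span `2 * m + 2 * n + 2`; multiplying by such a pair also gains the current degree
`r` (`HasSpan.boxProd`). The remaining even cycles come last.

Sharpness rests on the upper bound `HasIntervalColoring.hypercube_le`: on a path between two
vertices of the cube, always leaving along the cheapest useful direction, the least color rises by
at most `d - 1`, `d - 2`, and so on. -/

/-- An integer edge-coloring `c` of an `r`-regular graph for which the colors at each vertex `v`
are exactly `a v, …, a v + r - 1`, without repetition. -/
structure IsRegularColoring {V : Type*} (G : SimpleGraph V) (r : ℕ) (c : V → V → ℤ)
    (a : V → ℤ) : Prop where
  symm : ∀ u v, G.Adj u v → c u v = c v u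
  bijOn : ∀ v, BijOn (c v) (G.neighborSet v) (Ico (a v) (a v + r))

/-- `G` is `r`-regular and has an interval coloring by integers whose least and greatest colors
span at least `T` integers. -/
def HasSpan {V : Type*} (G : SimpleGraph V) (r T : ℕ) : Prop :=
  ∃ c a, IsRegularColoring G r c a ∧ ∃ u u', (T : ℤ) ≤ a u' + r - a u

/-! ### Invariance under isomorphism -/

section Isomorphism

variable {V W : Type*} {G : SimpleGraph V} {H : SimpleGraph W}

theorem HasSpan.of_iso {r T : ℕ} (h : HasSpan G r T) (e : H ≃g G) : HasSpan H r T := by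
  obtain ⟨c, a, hc, u, u', hT⟩ := h
  refine ⟨fun x y => c (e x) (e y), fun x => a (e x),
    ⟨fun x y hxy => hc.symm _ _ (e.map_adj_iff.2 hxy), fun x => ?_⟩,
    e.symm u, e.symm u', by simpa using hT⟩
  refine (hc.bijOn (e x)).comp ⟨fun y hy => e.map_adj_iff.2 hy, e.injective.injOn, fun y hy => ?_⟩
  exact ⟨e.symm y, by rw [mem_neighborSet, ← e.map_adj_iff]; simpa using hy, by simp⟩

theorem HasIntervalColoring.of_iso {t : ℕ} (h : HasIntervalColoring G t) (e : H ≃g G) :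
    HasIntervalColoring H t := by
  obtain ⟨α, hα⟩ := h
  have hmem : ∀ (v : W) (x : H.edgeSet), v ∈ (x : Sym2 W) ↔ e v ∈ (e.mapEdgeSet x : Sym2 V) := by
    rintro v ⟨x, hx⟩
    change _ ↔ e v ∈ Sym2.map e x
    rw [Sym2.mem_map]
    exact ⟨fun h => ⟨v, h, rfl⟩, fun ⟨w, hw, h⟩ => e.injective h ▸ hw⟩
  refine ⟨α ∘ e.mapEdgeSet, ⟨?_, ?_, ?_⟩⟩
  · intro v x y hx hy hxy
    exact hα.proper (e v) _ _ ((hmem v x).1 hx) ((hmem v y).1 hy)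
      (e.mapEdgeSet.injective.ne hxy)
  · rw [e.mapEdgeSet.surjective.range_comp, hα.range_eq]
  · intro v
    obtain ⟨a, b, hab⟩ := hα.interval (e v)
    refine ⟨a, b, ?_⟩
    rw [← hab]
    ext c
    constructor
    · rintro ⟨x, hx, rfl⟩
      exact ⟨_, (hmem v x).1 hx, rfl⟩
    · rintro ⟨y, hy, rfl⟩
      obtain ⟨x, rfl⟩ := e.mapEdgeSet.surjective y
      exact ⟨x, (hmem v x).2 hy, rfl⟩

theorem maxColors_congr (e : G ≃g H) : maxColors G = maxColors H := by
  unfold maxColors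
  congr 1
  ext t
  exact ⟨fun h => h.of_iso e.symm, fun h => h.of_iso e⟩

variable {V' W' : Type*} {G' : SimpleGraph V'} {H' : SimpleGraph W'}

/-- Isomorphic factors give isomorphic box products. -/
def boxProdCongr (e : G ≃g G') (f : H ≃g H') : G.boxProd H ≃g G'.boxProd H' where
  toEquiv := e.toEquiv.prodCongr f.toEquiv
  map_rel_iff' := by
    intro x y
    simp [boxProd_adj, Equiv.prodCongr_apply, e.map_adj_iff, f.map_adj_iff]

end Isomorphism

/-! ### Rearranging Cartesian products -/

section Product

variable {ι : Type*} {W W' : ι → Type*}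

/-- Isomorphic factors give isomorphic Cartesian products. -/
def cartesianProductCongr {G : ∀ i, SimpleGraph (W i)} {H : ∀ i, SimpleGraph (W' i)}
    (e : ∀ i, G i ≃g H i) : cartesianProduct G ≃g cartesianProduct H where
  toEquiv := Equiv.piCongrRight fun i => (e i).toEquiv
  map_rel_iff' := by
    intro x y
    simp [cartesianProduct, Pi.map, (e _).map_adj_iff]

/-- A Cartesian product of box products is the box product of the Cartesian products. -/
def cartesianProductBoxProd (G : ∀ i, SimpleGraph (W i)) (H : ∀ i, SimpleGraph (W' i)) :
    cartesianProduct (fun i => (G i).boxProd (H i)) ≃g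
      (cartesianProduct G).boxProd (cartesianProduct H) where
  toEquiv := Equiv.arrowProdEquivProdArrow ι W W'
  map_rel_iff' := by
    intro x y
    simp only [Equiv.arrowProdEquivProdArrow, Equiv.coe_fn_mk, boxProd_adj, cartesianProduct,
      funext_iff, Prod.ext_iff]
    constructor
    · rintro (⟨⟨i, h, h'⟩, h2⟩ | ⟨⟨i, h, h'⟩, h2⟩)
      · exact ⟨i, .inl ⟨h, h2 i⟩, fun j hj => ⟨h' j hj, h2 j⟩⟩
      · exact ⟨i, .inr ⟨h, h2 i⟩, fun j hj => ⟨h2 j, h' j hj⟩⟩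
    · rintro ⟨i, ⟨h, h2⟩ | ⟨h, h2⟩, h'⟩
      · refine .inl ⟨⟨i, h, fun j hj => (h' j hj).1⟩, fun j => ?_⟩
        by_cases hj : j = i
        · exact hj ▸ h2
        · exact (h' j hj).2
      · refine .inr ⟨⟨i, h, fun j hj => (h' j hj).2⟩, fun j => ?_⟩
        by_cases hj : j = i
        · exact hj ▸ h2
        · exact (h' j hj).1

/-- The Cartesian product of two lists of graphs is the box product of their products. -/
def cartesianProductAdd {k l : ℕ} {W : Fin (k + l) → Type*} (G : ∀ i, SimpleGraph (W i)) :
    cartesianProduct G ≃g (cartesianProduct fun i => G (Fin.castAdd l i)).boxProd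
      (cartesianProduct fun i => G (Fin.natAdd k i)) where
  toFun x := (fun i => x (Fin.castAdd l i), fun i => x (Fin.natAdd k i))
  invFun p := Fin.addCases p.1 p.2
  left_inv x := by
    funext i
    refine Fin.addCases (fun i => ?_) (fun i => ?_) i <;> simp
  right_inv p := by simp
  map_rel_iff' := by
    intro x y
    simp only [Equiv.coe_fn_mk, boxProd_adj, cartesianProduct, funext_iff]
    constructor
    · rintro (⟨⟨i, h, h'⟩, h2⟩ | ⟨⟨i, h, h'⟩, h2⟩)
      · refine ⟨_, h, fun j => Fin.addCases (fun j hj => h' j ?_) (fun j _ => h2 j) j⟩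
        rintro rfl; exact hj rfl
      · refine ⟨_, h, fun j => Fin.addCases (fun j _ => h2 j) (fun j hj => h' j ?_) j⟩
        rintro rfl; exact hj rfl
    · rintro ⟨i, h, h'⟩
      revert h h'
      refine Fin.addCases (fun i h h' => .inl ⟨⟨i, h, fun j hj => h' _ ?_⟩, fun j => h' _ ?_⟩)
        (fun i h h' => .inr ⟨⟨i, h, fun j hj => h' _ ?_⟩, fun j => h' _ ?_⟩) i
      · simpa [Fin.ext_iff] using hj
      · simp only [ne_eq, Fin.ext_iff, Fin.val_natAdd, Fin.val_castAdd]; omega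
      · simpa [Fin.ext_iff] using hj
      · simp only [ne_eq, Fin.ext_iff, Fin.val_natAdd, Fin.val_castAdd]; omega

/-- The Cartesian product of one graph. -/
def cartesianProductOne {W : Fin 1 → Type*} (G : ∀ i, SimpleGraph (W i)) :
    cartesianProduct G ≃g G 0 where
  toEquiv := Equiv.piUnique W
  map_rel_iff' := by
    intro x y
    simp [cartesianProduct, Fin.exists_fin_one, Fin.forall_fin_one]

/-- Splitting off the last factor of a Cartesian product. -/
def cartesianProductSnoc {k : ℕ} {W : Fin (k + 1) → Type*} (G : ∀ i, SimpleGraph (W i)) :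
    cartesianProduct G ≃g
      (cartesianProduct fun i : Fin k => G i.castSucc).boxProd (G (Fin.last k)) :=
  (cartesianProductAdd G).trans (boxProdCongr .refl (cartesianProductOne _))

/-- The box product with a graph on one vertex. -/
def uniqueBoxProd {U V : Type*} [Unique U] (H : SimpleGraph U) (G : SimpleGraph V) :
    H.boxProd G ≃g G where
  toEquiv := Equiv.uniqueProd V U
  map_rel_iff' := by
    rintro ⟨u, x⟩ ⟨u', y⟩
    obtain rfl : u = u' := Subsingleton.elim _ _
    simp [boxProd_adj]

theorem nonempty_torus_append {k l : ℕ} (f : Fin k → ℕ) (g : Fin l → ℕ) :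
    Nonempty (torus (Fin.append f g) ≃g (torus f).boxProd (torus g)) := by
  -- The vertex types depend on the side lengths, so the equations for `Fin.append` are made
  -- hypotheses and eliminated by substitution.
  have key : ∀ (f' : Fin k → ℕ) (g' : Fin l → ℕ),
      (fun i => Fin.append f g (Fin.castAdd l i)) = f' →
      (fun i => Fin.append f g (Fin.natAdd k i)) = g' →
      Nonempty (torus (Fin.append f g) ≃g (torus f').boxProd (torus g')) := by
    rintro _ _ rfl rfl
    exact ⟨cartesianProductAdd _⟩
  exact key f g (funext fun i => by simp) (funext fun i => by simp)

theorem connected_cartesianProduct : ∀ {k : ℕ} {W : Fin k → Type*} (G : ∀ i, SimpleGraph (W i)),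
    (∀ i, (G i).Connected) → (cartesianProduct G).Connected
  | 0, W, G, _ => by
    have : Nonempty (∀ i, W i) := ⟨fun i => i.elim0⟩
    exact ⟨fun x y => by rw [Subsingleton.elim x y]⟩
  | k + 1, W, G, h => by
    rw [(cartesianProductSnoc G).connected_iff]
    exact (connected_cartesianProduct _ fun i => h _).boxProd (h _)

theorem connected_torus {k : ℕ} (a : Fin k → ℕ) (ha : ∀ i, 0 < a i) : (torus a).Connected := by
  refine connected_cartesianProduct _ fun i => ?_
  obtain ⟨m, hm⟩ := Nat.exists_eq_succ_of_ne_zero (ha i).ne'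
  rw [hm]
  exact cycleGraph_connected

end Product

/-! ### From integer colorings to interval colorings -/

/-- An integer coloring of a connected regular graph that spans `T` colors yields an interval
coloring with at least `T` colors. -/
theorem HasSpan.exists_hasIntervalColoring {V : Type*} [Finite V] {G : SimpleGraph V} {r T : ℕ}
    (h : HasSpan G r T) (hr : 0 < r) (hG : G.Connected) :
    ∃ t, 0 < t ∧ T ≤ t ∧ HasIntervalColoring G t := by
  obtain ⟨c, a, hc, w, w', hT⟩ := h
  have : Nonempty V := hG.nonempty
  obtain ⟨u, hu⟩ := Finite.exists_min a
  obtain ⟨u', hu'⟩ := Finite.exists_max a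
  have hcov : ∀ x, a u ≤ x → x < a u' + r → ∃ v, a v ≤ x ∧ x < a v + r := by
    intro x hx hx'
    by_contra! hno
    -- If no interval contains `x`, each one lies entirely below or entirely above `x`. The color of
    -- an edge belongs to both end intervals, so no edge joins the two kinds.
    have hstep : ∀ v v', G.Adj v v' → a v ≤ x → a v' ≤ x := by
      intro v v' hv h
      have h1 := (hc.bijOn v).mapsTo hv
      have h2 := (hc.bijOn v').mapsTo hv.symm
      rw [← hc.symm _ _ hv] at h2
      have := hno v h
      exact h2.1.trans (h1.2.le.trans this)
    have hall : a u' ≤ x := by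
      have hwalk : ∀ v v' (_ : G.Walk v v'), a v ≤ x → a v' ≤ x := by
        intro v v' p
        induction p with
        | nil => exact id
        | cons hadj _ ih => exact fun h => ih (hstep _ _ hadj h)
      obtain ⟨p⟩ := hG.preconnected u u'
      exact hwalk u u' p hx
    exact absurd (hno u' hall) (not_le.2 hx')
  -- Translation sends the least color `a u` to 1. The orientation chosen by `out` is irrelevant by
  -- the symmetry of `c`.
  set α : G.edgeSet → ℕ := fun e => (c (e : Sym2 V).out.1 (e : Sym2 V).out.2 - a u + 1).toNat
    with hα
  have hαc : ∀ x y (hxy : G.Adj x y), (α ⟨s(x, y), hxy⟩ : ℤ) = c x y - a u + 1 := by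
    intro x y hxy
    have hge : a u ≤ c x y := (hu x).trans ((hc.bijOn x).mapsTo hxy).1
    have hout : c (s(x, y) : Sym2 V).out.1 (s(x, y) : Sym2 V).out.2 = c x y := by
      have := Quot.out_eq (s(x, y) : Sym2 V)
      have h2 : s((s(x, y) : Sym2 V).out.1, (s(x, y) : Sym2 V).out.2) = s(x, y) := this
      rcases Sym2.eq_iff.1 h2 with ⟨h, h'⟩ | ⟨h, h'⟩
      · rw [h, h']
      · rw [h, h', hc.symm _ _ hxy]
    simp only [hα, hout]
    omega
  refine ⟨(a u' + r - a u).toNat, ?_, ?_, α, ?_, ?_, ?_⟩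
  · have := hu u'
    omega
  · have h1 := hu w
    have h2 := hu' w'
    omega
  · rintro v ⟨e, he⟩ ⟨f, hf⟩ hve hvf hne heq
    obtain ⟨x, rfl⟩ := Sym2.mem_iff_exists.1 hve
    obtain ⟨y, rfl⟩ := Sym2.mem_iff_exists.1 hvf
    have h1 := hαc v x he
    have h2 := hαc v y hf
    rw [heq] at h1
    have hxy : c v x = c v y := by omega
    obtain rfl : x = y := (hc.bijOn v).injOn he hf hxy
    exact hne rfl
  · ext x
    constructor
    · rintro ⟨⟨e, he⟩, rfl⟩
      induction e with | _ v y
      have h1 := hαc v y he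
      have h2 := (hc.bijOn v).mapsTo he
      have h3 := hu v
      have h4 := hu' v
      simp only [Set.mem_Icc, Set.mem_Ico] at *
      omega
    · intro hx
      simp only [Set.mem_Icc] at hx
      obtain ⟨v, hv⟩ := hcov (x - 1 + a u) (by omega) (by omega)
      obtain ⟨y, hy, hxy⟩ := (hc.bijOn v).surjOn hv
      refine ⟨⟨s(v, y), hy⟩, ?_⟩
      have := hαc v y hy
      omega
  · intro v
    refine ⟨(a v - a u + 1).toNat, (a v + r - a u).toNat, ?_⟩
    have h3 := hu v
    ext x
    constructor
    · rintro ⟨⟨e, he⟩, hve, rfl⟩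
      obtain ⟨y, rfl⟩ := Sym2.mem_iff_exists.1 hve
      have h1 := hαc v y he
      have h2 := (hc.bijOn v).mapsTo he
      simp only [Set.mem_Icc, Set.mem_Ico] at *
      omega
    · intro hx
      simp only [Set.mem_Icc] at hx
      obtain ⟨y, hy, hxy⟩ := (hc.bijOn v).surjOn
        (show (x : ℤ) - 1 + a u ∈ Set.Ico (a v) (a v + r) from ⟨by omega, by omega⟩)
      refine ⟨⟨s(v, y), hy⟩, Sym2.mem_mk_left _ _, ?_⟩
      have := hαc v y hy
      omega

/-! ### Colorings of box products -/

open Classical in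
/-- Regular colorings of the fibers of a box product, with complementary color sets at each
vertex, form a regular coloring of the product. -/
theorem isRegularColoring_boxProd {V W : Type*} {G : SimpleGraph V} {H : SimpleGraph W} {r : ℕ}
    {p : W → V → V → ℤ} {q : V → W → W → ℤ} {A B : V → W → Set ℤ} {a : V × W → ℤ}
    (hp : ∀ w v v', G.Adj v v' → p w v v' = p w v' v)
    (hq : ∀ v w w', H.Adj w w' → q v w w' = q v w' w)
    (hA : ∀ v w, BijOn (p w v) (G.neighborSet v) (A v w))
    (hB : ∀ v w, BijOn (q v w) (H.neighborSet w) (B v w))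
    (hd : ∀ v w, ∀ x ∈ A v w, x ∉ B v w)
    (hu : ∀ v w, ∀ x, x ∈ A v w ∨ x ∈ B v w ↔ a (v, w) ≤ x ∧ x < a (v, w) + r) :
    IsRegularColoring (G.boxProd H) r
      (fun x y => if x.2 = y.2 then p x.2 x.1 y.1 else q x.1 x.2 y.2) a := by
  constructor
  · rintro ⟨v, w⟩ ⟨v', w'⟩ (⟨h, h'⟩ | ⟨h, h'⟩)
    · obtain rfl : w = w' := h'
      simpa using hp _ _ _ h
    · obtain rfl : v = v' := h'
      simpa [h.ne, h.ne.symm] using hq _ _ _ h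
  · rintro ⟨v, w⟩
    refine ⟨?_, ?_, ?_⟩
    · rintro ⟨v', w'⟩ (⟨h, h'⟩ | ⟨h, h'⟩)
      · obtain rfl : w = w' := h'
        simpa using (hu v w _).1 (.inl ((hA v w).mapsTo h))
      · obtain rfl : v = v' := h'
        simpa [h.ne] using (hu v w _).1 (.inr ((hB v w).mapsTo h))
    · rintro ⟨v₁, w₁⟩ (⟨h₁, h₁'⟩ | ⟨h₁, h₁'⟩) ⟨v₂, w₂⟩ (⟨h₂, h₂'⟩ | ⟨h₂, h₂'⟩) h
      · obtain rfl : w = w₁ := h₁'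
        obtain rfl : w = w₂ := h₂'
        simp only [if_true] at h
        exact Prod.ext ((hA v w).injOn h₁ h₂ h) rfl
      · obtain rfl : w = w₁ := h₁'
        obtain rfl : v = v₂ := h₂'
        simp only [if_true, if_neg h₂.ne] at h
        exact absurd ((hB v w).mapsTo h₂) (h ▸ hd v w _ ((hA v w).mapsTo h₁))
      · obtain rfl : v = v₁ := h₁'
        obtain rfl : w = w₂ := h₂'
        simp only [if_true, if_neg h₁.ne] at h
        exact absurd ((hB v w).mapsTo h₁) (h ▸ hd v w _ ((hA v w).mapsTo h₂))
      · obtain rfl : v = v₁ := h₁'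
        obtain rfl : v = v₂ := h₂'
        simp only [if_neg h₁.ne, if_neg h₂.ne] at h
        exact Prod.ext rfl ((hB v w).injOn h₁ h₂ h)
    · intro x hx
      rcases (hu v w x).2 hx with h | h
      · obtain ⟨v', hv, rfl⟩ := (hA v w).surjOn h
        exact ⟨(v', w), .inl ⟨hv, rfl⟩, by simp⟩
      · obtain ⟨w', hw, rfl⟩ := (hB v w).surjOn h
        exact ⟨(v, w'), .inr ⟨hw, rfl⟩, by simp [hw.ne]⟩

/-- The box product of a regularly colored graph `G` with a graph `H` whose edges are colored
so that the colors at each vertex leave a slot of length `r` for a shifted copy of `G`. -/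
theorem HasSpan.boxProd_of_slots {V W : Type*} {G : SimpleGraph V} {H : SimpleGraph W}
    {r r' T D : ℕ} (h : HasSpan G r T) (f : W → W → ℤ) (s b : W → ℤ)
    (hf : ∀ w w', H.Adj w w' → f w w' = f w' w)
    (hB : ∀ w, BijOn (f w) (H.neighborSet w) (Ico (b w) (b w + r + r') \ Ico (s w) (s w + r)))
    (hs : ∀ w, b w ≤ s w ∧ s w ≤ b w + r') (w w' : W) (hD : (D : ℤ) ≤ b w' + r' - b w) :
    HasSpan (G.boxProd H) (r + r') (T + D) := by
  obtain ⟨c, a, hc, u, u', hT⟩ := h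
  refine ⟨_, fun x => a x.1 + b x.2, isRegularColoring_boxProd
    (p := fun w v v' => c v v' + s w) (q := fun v w w' => a v + f w w')
    (A := fun v w => Ico (a v + s w) (a v + s w + r))
    (B := fun v w => (fun x => a v + x) '' (Ico (b w) (b w + r + r') \ Ico (s w) (s w + r)))
    ?_ ?_ ?_ ?_ ?_ ?_, (u, w), (u', w'), ?_⟩
  · intro w v v' h
    simp only [hc.symm _ _ h]
  · intro v w w' h
    simp only [hf _ _ h]
  · intro v w
    have h1 : BijOn (fun x => x + s w) (Ico (a v) (a v + r))
        (Ico (a v + s w) (a v + s w + r)) := by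
      refine ⟨fun x hx => ?_, (add_left_injective _).injOn, fun x hx => ⟨x - s w, ?_, by simp⟩⟩
      · simp only [Set.mem_Ico] at *; omega
      · simp only [Set.mem_Ico] at *; omega
    exact h1.comp (hc.bijOn v)
  · intro v w
    exact ((add_right_injective (a v)).injOn.bijOn_image).comp (hB w)
  · rintro v w x hx ⟨y, hy, rfl⟩
    simp only [Set.mem_Ico, Set.mem_sdiff] at *
    omega
  · intro v w x
    have := hs w
    constructor
    · rintro (hx | ⟨y, hy, rfl⟩)
      · simp only [Set.mem_Ico] at hx; push_cast; omega
      · simp only [Set.mem_Ico, Set.mem_sdiff] at hy; push_cast; omega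
    · intro hx
      push_cast at hx
      by_cases hx' : x ∈ Ico (a v + s w) (a v + s w + r)
      · exact .inl hx'
      · refine .inr ⟨x - a v, ?_, by simp⟩
        simp only [Set.mem_Ico, Set.mem_sdiff] at *
        omega
  · push_cast
    omega

/-- Colorings of two regular graphs combine so that the spans and the degree of the first graph
add up. -/
theorem HasSpan.boxProd {V W : Type*} {G : SimpleGraph V} {H : SimpleGraph W}
    {r r' T T' : ℕ} (hG : HasSpan G r T) (hH : HasSpan H r' T') (hT : r' < T') :
    HasSpan (G.boxProd H) (r + r') (T + (T' + r)) := by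
  classical
  obtain ⟨c, b, hc, u, u', hT'⟩ := hH
  have hne : u' ≠ u := by
    rintro rfl
    omega
  -- The slot lies below the colors of `H` at `u` and above them everywhere else, so the span grows
  -- by `r` beyond `T'`. This needs `u' ≠ u`, which `r' < T'` guarantees.
  refine hG.boxProd_of_slots c (fun w => if w = u then b w - r else b w + r')
    (fun w => if w = u then b w - r else b w) hc.symm (fun w => ?_) (fun w => ?_) u u' ?_
  · convert hc.bijOn w using 1
    ext x
    simp only [Set.mem_Ico, Set.mem_sdiff]
    split_ifs <;> omega
  · split_ifs <;> omega
  · simp only [if_true, if_neg hne]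
    push_cast
    omega

/-! ### Cycles as factors -/

section Cycle

theorem cycleGraph_adj_iff_val {N : ℕ} (hN : 2 ≤ N) (u v : Fin N) :
    (cycleGraph N).Adj u v ↔
      (v : ℕ) = (if (u : ℕ) + 1 < N then (u : ℕ) + 1 else 0) ∨
      (v : ℕ) = (if (u : ℕ) = 0 then N - 1 else (u : ℕ) - 1) := by
  rw [cycleGraph_adj']
  have hu := u.2
  have hv := v.2
  rcases lt_trichotomy u v with h | h | h
  · rw [Fin.coe_sub_iff_lt.2 h, Fin.coe_sub_iff_le.2 h.le]
    rw [Fin.lt_def] at h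
    split_ifs <;> omega
  · subst h
    rw [Fin.coe_sub_iff_le.2 le_rfl]
    split_ifs <;> omega
  · rw [Fin.coe_sub_iff_lt.2 h, Fin.coe_sub_iff_le.2 h.le]
    rw [Fin.lt_def] at h
    split_ifs <;> omega

/-- The edge-coloring of the cycle in which the edge from `i` to `i + 1` has color `g i`. -/
def cycleColor {N : ℕ} (g : ℕ → ℤ) (u v : Fin N) : ℤ :=
  if (v : ℕ) = (if (u : ℕ) + 1 < N then (u : ℕ) + 1 else 0) then g u else g v

/-- For `3 ≤ N` successor and predecessor differ, so the test in `cycleColor` succeeds from exactly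
one end of each edge. -/
theorem cycleColor_symm {N : ℕ} (hN : 3 ≤ N) (g : ℕ → ℤ) (u v : Fin N)
    (h : (cycleGraph N).Adj u v) : cycleColor g u v = cycleColor g v u := by
  rw [cycleGraph_adj_iff_val (by omega)] at h
  have hu := u.2
  have hv := v.2
  unfold cycleColor
  split_ifs at * <;> first | rfl | omega

theorem cycleColor_bijOn {N : ℕ} (hN : 3 ≤ N) (g : ℕ → ℤ) (u : Fin N)
    (h : g u ≠ g (if (u : ℕ) = 0 then N - 1 else u - 1)) :
    BijOn (cycleColor g u) ((cycleGraph N).neighborSet u)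
      {g u, g (if (u : ℕ) = 0 then N - 1 else u - 1)} := by
  have hu := u.2
  set i := if (u : ℕ) + 1 < N then (u : ℕ) + 1 else 0 with hi
  set j := if (u : ℕ) = 0 then N - 1 else (u : ℕ) - 1 with hj
  have hiN : i < N := by grind
  have hjN : j < N := by grind
  have hij : i ≠ j := by grind
  have hset : (cycleGraph N).neighborSet u = {⟨i, hiN⟩, ⟨j, hjN⟩} := by
    ext v
    rw [mem_neighborSet, cycleGraph_adj_iff_val (by omega)]
    simp [Fin.ext_iff, hi, hj]
  have h1 : cycleColor g u ⟨i, hiN⟩ = g u := by simp [cycleColor, ← hi]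
  have h2 : cycleColor g u ⟨j, hjN⟩ = g j := by simp [cycleColor, ← hi, hij.symm]
  rw [hset, ← h1, ← h2, ← image_pair]
  refine InjOn.bijOn_image ?_
  rw [injOn_pair, h1, h2]
  exact fun h' => absurd h' h

end Cycle

/-- The box product with an even cycle. -/
theorem HasSpan.boxProd_cycleGraph_even {V : Type*} {G : SimpleGraph V} {r T n : ℕ}
    (h : HasSpan G r T) (hn : 2 ≤ n) :
    HasSpan (G.boxProd (cycleGraph (2 * n))) (r + 2) (T + (n * (r + 1) + 1)) := by
  -- Colors climb in steps of `r + 1` on one half of the cycle and descend likewise on the other,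
  -- leaving exactly `r` free colors between the two edges at a vertex. At the turning vertices 0
  -- and `n` the two colors are consecutive; the slot lies below them at 0 and above them at `n`.
  set g : ℕ → ℤ := fun i => if i < n then (i : ℤ) * (r + 1) + r else (2 * n - i) * (r + 1)
    with hg
  set b : Fin (2 * n) → ℤ := fun i => if (i : ℕ) = 0 then 0 else
    if (i : ℕ) ≤ n then (i : ℤ) * (r + 1) - 1 else (2 * n - i) * (r + 1) with hb
  set s : Fin (2 * n) → ℤ := fun i => if (i : ℕ) < n then (i : ℤ) * (r + 1) else
    (2 * n - i) * (r + 1) + 1 with hs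
  have hpair : ∀ i : Fin (2 * n), g i ≠ g (if (i : ℕ) = 0 then 2 * n - 1 else i - 1) ∧
      ({g i, g (if (i : ℕ) = 0 then 2 * n - 1 else i - 1)} : Set ℤ) =
        Ico (b i) (b i + r + (2 : ℕ)) \ Ico (s i) (s i + r) ∧
      b i ≤ s i ∧ s i ≤ b i + (2 : ℕ) := by
    intro i
    have hi := i.2
    rcases Nat.eq_zero_or_pos (i : ℕ) with h0 | h0
    · have h1 : g i = r := by simp [hg, h0]; omega
      have h2 : g (2 * n - 1) = r + 1 := by
        simp only [hg]
        rw [if_neg (by omega), Nat.cast_sub (by omega)]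
        push_cast; ring
      have h3 : b i = 0 := by simp [hb, h0]
      have h4 : s i = 0 := by simp [hs, h0]; omega
      rw [if_pos h0, h1, h2, h3, h4]
      refine ⟨by omega, ?_, by omega, by omega⟩
      ext x
      simp only [mem_insert_iff, mem_singleton_iff, Set.mem_sdiff, Set.mem_Ico]
      omega
    · rw [if_neg h0.ne']
      obtain ⟨j, hj⟩ := Nat.exists_eq_succ_of_ne_zero h0.ne'
      have hj1 : (i : ℕ) - 1 = j := by omega
      rw [hj1]
      rcases lt_trichotomy (i : ℕ) n with hin | hin | hin
      · have h1 : g i = (i : ℤ) * (r + 1) + r := by simp [hg, hin]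
        have h2 : g j = (i : ℤ) * (r + 1) - 1 := by
          simp only [hg, hj]
          rw [if_pos (by omega)]
          push_cast; ring
        have h3 : b i = (i : ℤ) * (r + 1) - 1 := by simp [hb, h0.ne', hin.le]
        have h4 : s i = (i : ℤ) * (r + 1) := by simp [hs, hin]
        rw [h1, h2, h3, h4]
        generalize (i : ℤ) * (r + 1) = y
        refine ⟨by omega, ?_, by omega, by omega⟩
        ext x
        simp only [mem_insert_iff, mem_singleton_iff, Set.mem_sdiff, Set.mem_Ico]
        omega
      · have h1 : g i = (n : ℤ) * (r + 1) := by
          simp only [hg, hin, lt_irrefl, if_false]; ring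
        have h2 : g j = (n : ℤ) * (r + 1) - 1 := by
          simp only [hg, ← hin, hj]
          rw [if_pos (by omega)]
          push_cast; ring
        have h3 : b i = (n : ℤ) * (r + 1) - 1 := by simp [hb, hin]; omega
        have h4 : s i = (n : ℤ) * (r + 1) + 1 := by
          simp only [hs, hin, lt_irrefl, if_false]; ring
        rw [h1, h2, h3, h4]
        generalize (n : ℤ) * (r + 1) = y
        refine ⟨by omega, ?_, by omega, by omega⟩
        ext x
        simp only [mem_insert_iff, mem_singleton_iff, Set.mem_sdiff, Set.mem_Ico]
        omega
      · have h1 : g i = (2 * n - i : ℤ) * (r + 1) := by simp [hg, hin.le]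
        have h2 : g j = (2 * n - i : ℤ) * (r + 1) + (r + 1) := by
          simp only [hg, hj]
          rw [if_neg (by omega)]
          push_cast; ring
        have h3 : b i = (2 * n - i : ℤ) * (r + 1) := by simp [hb, h0.ne', hin]
        have h4 : s i = (2 * n - i : ℤ) * (r + 1) + 1 := by simp [hs, hin.le]
        rw [h1, h2, h3, h4]
        generalize (2 * n - i : ℤ) * (r + 1) = y
        refine ⟨by omega, ?_, by omega, by omega⟩
        ext x
        simp only [mem_insert_iff, mem_singleton_iff, Set.mem_sdiff, Set.mem_Ico]
        omega
  refine h.boxProd_of_slots (cycleColor g) s b (cycleColor_symm (by omega) g) (fun i => ?_)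
    (fun i => (hpair i).2.2) ⟨0, by omega⟩ ⟨n, by omega⟩ ?_
  · rw [← (hpair i).2.1]
    exact cycleColor_bijOn (by omega) g i (hpair i).1
  · have : n ≠ 0 := by omega
    simp only [hb, if_true, if_neg this, le_refl]
    push_cast
    omega

/-! ### The product of an even and an odd cycle -/

/-- Two pairs of integers that together form a block of four consecutive integers. -/
def FormBlock (e e' c c' a : ℤ) : Prop :=
  e ≠ e' ∧ c ≠ c' ∧ (e ≠ c ∧ e ≠ c' ∧ e' ≠ c ∧ e' ≠ c') ∧
    ∀ x, ((x = e ∨ x = e') ∨ (x = c ∨ x = c')) ↔ a ≤ x ∧ x < a + 4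

theorem FormBlock.swap_left {e e' c c' a : ℤ} (h : FormBlock e e' c c' a) :
    FormBlock e' e c c' a := by
  obtain ⟨h1, h2, h3, h4⟩ := h
  exact ⟨h1.symm, h2, by tauto, fun x => by rw [← h4 x]; tauto⟩

theorem FormBlock.swap_right {e e' c c' a : ℤ} (h : FormBlock e e' c c' a) :
    FormBlock e e' c' c a := by
  obtain ⟨h1, h2, h3, h4⟩ := h
  exact ⟨h1, h2.symm, by tauto, fun x => by rw [← h4 x]; tauto⟩

/-- The pair `c, c'` moves up by 4 at every second level while `E` rises by 2 per level on average.
A pair with gap 2 interlaces with consecutive odd offsets. A pair of neighbors needs a parity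
correction, and either sign works. -/
theorem exists_formBlock {E : ℤ → ℤ} {c c' x : ℤ}
    (h : (c = x ∧ c' = x + 2 ∧ ∀ q, E q = x + 2 * q + 3) ∨
      (c = x ∧ c' = x + 1 ∧ ∀ q, E q = x + 2 * q + 2 - q % 2) ∨
      (c = x ∧ c' = x + 1 ∧ ∀ q, E q = x + 2 * q + 3 + q % 2)) (p : ℤ) :
    ∃ a, FormBlock (E p) (E (p - 1)) (c + 4 * ((p + 1) / 2)) (c' + 4 * ((p + 1) / 2)) a := by
  unfold FormBlock
  rcases Int.emod_two_eq_zero_or_one p with hp | hp <;>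
    rcases h with ⟨rfl, rfl, h⟩ | ⟨rfl, rfl, h⟩ | ⟨rfl, rfl, h⟩ <;> rw [h p, h (p - 1)]
  · exact ⟨c + 2 * p, by omega, by omega, by omega, fun x => by omega⟩
  · exact ⟨c + 2 * p - 1, by omega, by omega, by omega, fun x => by omega⟩
  · exact ⟨c + 2 * p, by omega, by omega, by omega, fun x => by omega⟩
  · exact ⟨c + 2 * p + 1, by omega, by omega, by omega, fun x => by omega⟩
  · exact ⟨c + 2 * p, by omega, by omega, by omega, fun x => by omega⟩
  · exact ⟨c + 2 * p + 1, by omega, by omega, by omega, fun x => by omega⟩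

/-- The box product of an even and an odd cycle. -/
theorem hasSpan_cycleGraph_even_boxProd_odd {m n : ℕ} (hm : 1 ≤ m) (hn : 2 ≤ n) :
    HasSpan ((cycleGraph (2 * n)).boxProd (cycleGraph (2 * m + 1))) 4
      (2 * m + 2 * n + 2) := by
  -- Odd colors go up one side of the odd cycle and even colors come down the other, so the two
  -- colors at a vertex differ by 2, except at the turning vertices 0 and `m + 1`, where they differ
  -- by 1.
  set γ : ℕ → ℤ := fun j => if j ≤ m then 2 * j + 1 else 2 * (2 * m + 1 - j) with hγ
  -- The even cycle is folded onto a path: `i` and `2 * n - 1 - i` share the level `lev i`, and the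
  -- edges at level `p` carry the indices `p - 1` and `p`. The two folding edges have indices `-1`
  -- and `n - 1`.
  set idx : ℕ → ℤ := fun i => if i < n then (i : ℤ) else 2 * n - 2 - i with hidx
  set lev : ℕ → ℤ := fun i => if i < n then (i : ℤ) else 2 * n - 1 - i with hlev
  -- Of the two parity corrections, the lower is used at `j = 0` and the higher at `j = m + 1`, to
  -- widen the span.
  set E : ℕ → ℤ → ℤ := fun j q =>
    if j = 0 then 1 + 2 * q + 2 - q % 2 else if j = m + 1 then 2 * m + 2 * q + 3 + q % 2 else
    if j ≤ m then 2 * j - 1 + 2 * q + 3 else 2 * (2 * m + 1 - j) + 2 * q + 3 with hE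
  set pr : ℕ → ℕ → ℕ := fun N i => if i = 0 then N - 1 else i - 1 with hpr
  set sh : ℕ → ℤ := fun i => 4 * ((lev i + 1) / 2) with hsh
  have hidx_pr : ∀ i, i < 2 * n → (idx i = lev i ∧ idx (pr (2 * n) i) = lev i - 1) ∨
      (idx i = lev i - 1 ∧ idx (pr (2 * n) i) = lev i) := by
    intro i hi
    simp only [hidx, hlev, hpr]
    split_ifs <;> omega
  have hcol : ∀ j, j < 2 * m + 1 → ∀ p, ∃ a, FormBlock (E j p) (E j (p - 1))
      (γ j + 4 * ((p + 1) / 2)) (γ (pr (2 * m + 1) j) + 4 * ((p + 1) / 2)) a := by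
    intro j hj p
    simp only [hE, hγ, hpr]
    by_cases h0 : j = 0
    · simp only [h0, if_true]
      exact exists_formBlock (x := 1) (.inr (.inl ⟨by simp, by split_ifs <;> omega,
        fun q => rfl⟩)) p
    · by_cases h1 : j = m + 1
      · simp only [if_neg h0, if_pos h1]
        exact exists_formBlock (x := 2 * m) (.inr (.inr ⟨by split_ifs <;> omega,
          by split_ifs <;> omega, fun q => rfl⟩)) p
      · by_cases h2 : j ≤ m
        · simp only [if_neg h0, if_neg h1, if_pos h2]
          obtain ⟨a, ha⟩ := exists_formBlock (E := fun q => 2 * (j : ℤ) - 1 + 2 * q + 3)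
            (c := 2 * j - 1) (c' := 2 * j + 1) (.inl ⟨rfl, by ring, fun q => rfl⟩) p
          refine ⟨a, ?_⟩
          convert ha.swap_right using 2
          split_ifs <;> omega
        · simp only [if_neg h0, if_neg h1, if_neg h2]
          exact exists_formBlock (x := 2 * (2 * m + 1 - j)) (.inl ⟨rfl,
            by split_ifs <;> omega, fun q => rfl⟩) p
  have hblock : ∀ x : Fin (2 * n) × Fin (2 * m + 1), ∃ a, FormBlock (E x.2 (idx x.1))
      (E x.2 (idx (pr (2 * n) x.1))) (γ x.2 + sh x.1) (γ (pr (2 * m + 1) x.2) + sh x.1) a := by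
    rintro ⟨i, j⟩
    obtain ⟨a, ha⟩ := hcol j j.2 (lev i)
    rcases hidx_pr i i.2 with ⟨h, h'⟩ | ⟨h, h'⟩ <;> rw [h, h']
    exacts [⟨a, ha⟩, ⟨a, ha.swap_left⟩]
  choose a ha using hblock
  refine ⟨_, a, isRegularColoring_boxProd
    (G := cycleGraph (2 * n)) (H := cycleGraph (2 * m + 1)) (r := 4) (a := a)
    (p := fun j => cycleColor fun i => E j (idx i))
    (q := fun i => cycleColor fun j => γ j + sh i)
    (A := fun i j => {E j (idx i), E j (idx (pr (2 * n) i))})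
    (B := fun i j => {γ j + sh i, γ (pr (2 * m + 1) j) + sh i}) ?_ ?_ ?_ ?_ ?_ ?_,
    (⟨0, by omega⟩, ⟨0, by omega⟩), (⟨n, by omega⟩, ⟨m + 1, by omega⟩), ?_⟩
  · exact fun j => cycleColor_symm (by omega) _
  · exact fun i => cycleColor_symm (by omega) _
  · exact fun i j => cycleColor_bijOn (by omega) _ i (ha (i, j)).1
  · exact fun i j => cycleColor_bijOn (by omega) _ j (ha (i, j)).2.1
  · intro i j x hx hx'
    have := (ha (i, j)).2.2.1
    simp only [mem_insert_iff, mem_singleton_iff] at hx hx'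
    dsimp only at this
    omega
  · exact fun i j => (ha (i, j)).2.2.2
  -- The folding edges over the two turning vertices witness the span: one has color 0, the other
  -- color at least `2 * m + 2 * n + 1`.
  · have h0 := ((ha (⟨0, by omega⟩, ⟨0, by omega⟩)).2.2.2 _).1 (.inl (.inr rfl))
    have h1 := ((ha (⟨n, by omega⟩, ⟨m + 1, by omega⟩)).2.2.2 _).1 (.inl (.inr rfl))
    have e0 : E 0 (idx (pr (2 * n) 0)) = 0 := by
      simp only [hE, hidx, hpr]
      split_ifs <;> omega
    have e1 : E (m + 1) (idx (pr (2 * n) n)) = 2 * m + 2 * n + 1 + (n - 1 : ℤ) % 2 := by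
      have hn0 : n ≠ 0 := by omega
      have hlt : n - 1 < n := by omega
      simp only [hE, hidx, hpr, Nat.add_eq_zero_iff, one_ne_zero, and_false, if_false, if_true,
        if_neg hn0, if_pos hlt]
      push_cast [show 1 ≤ n by omega]
      ring
    dsimp only at h0 h1
    rw [e0] at h0
    rw [e1] at h1
    push_cast
    omega

/-! ### Assembling the tori -/

theorem hasSpan_of_unique {V : Type*} [Unique V] (G : SimpleGraph V) : HasSpan G 0 0 := by
  refine ⟨fun _ _ => 0, fun _ => 0, ⟨fun _ _ _ => rfl, fun v => ?_⟩, default, default, by simp⟩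
  simp

theorem HasSpan.boxProd_torus_even {V : Type*} {G : SimpleGraph V} {r T : ℕ}
    (h : HasSpan G r T) : ∀ {s : ℕ} (n : Fin s → ℕ), (∀ i, 2 ≤ n i) →
      HasSpan (G.boxProd (torus fun j => 2 * n j)) (r + 2 * s)
        (T + ∑ j : Fin s, (n j * (r + 2 * (j : ℕ) + 1) + 1))
  | 0, n, _ => by
    simpa using h.of_iso ((boxProdComm _ _).trans (uniqueBoxProd (torus fun j => 2 * n j) G))
  | s + 1, n, hn => by
    have ih := (h.boxProd_torus_even (fun j : Fin s => n j.castSucc)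
      fun j => hn _).boxProd_cycleGraph_even (hn (Fin.last s))
    have e : G.boxProd (torus fun j => 2 * n j) ≃g
        (G.boxProd (torus fun j : Fin s => 2 * n j.castSucc)).boxProd
          (cycleGraph (2 * n (Fin.last s))) :=
      (boxProdCongr .refl (cartesianProductSnoc _)).trans (boxProdAssoc _ _ _).symm
    rw [Fin.sum_univ_castSucc, ← add_assoc]
    exact ih.of_iso e

/-- With `i` pairs already present the degree is `4 * i`, so the next pair adds `2 * m + 2 * n + 2 +
4 * i`; the terms `2 + 4 * i` sum to `2 * k ^ 2`. -/
theorem hasSpan_cartesianProduct_even_boxProd_odd : ∀ {k : ℕ} (m n : Fin k → ℕ),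
    (∀ i, 1 ≤ m i) → (∀ i, 2 ≤ n i) →
      HasSpan (cartesianProduct fun i =>
          (cycleGraph (2 * n i)).boxProd (cycleGraph (2 * m i + 1)))
        (4 * k) (2 * k ^ 2 + 2 * ∑ i, (m i + n i))
  | 0, m, n, _, _ => by simpa using hasSpan_of_unique _
  | k + 1, m, n, hm, hn => by
    have hpair := hasSpan_cycleGraph_even_boxProd_odd (hm (Fin.last k)) (hn (Fin.last k))
    have ih := (hasSpan_cartesianProduct_even_boxProd_odd (fun i : Fin k => m i.castSucc)
      (fun i => n i.castSucc) (fun _ => hm _) fun _ => hn _).boxProd hpair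
      (by have := hn (Fin.last k); omega)
    have hT : 2 * (k + 1) ^ 2 + 2 * ∑ i, (m i + n i) =
        2 * k ^ 2 + 2 * ∑ i : Fin k, (m i.castSucc + n i.castSucc) +
          (2 * m (Fin.last k) + 2 * n (Fin.last k) + 2 + 4 * k) := by
      rw [Fin.sum_univ_castSucc]
      ring
    rw [hT]
    exact ih.of_iso (cartesianProductSnoc _)

theorem hasSpan_torus_even {k : ℕ} (n : Fin k → ℕ) (hn : ∀ i, 2 ≤ n i) :
    HasSpan (torus fun i => 2 * n i) (2 * k)
      (k + ∑ i : Fin k, n i * (2 * ((i : ℕ) + 1) - 1)) := by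
  have h := ((hasSpan_of_unique (⊥ : SimpleGraph Unit)).boxProd_torus_even n hn).of_iso
    (uniqueBoxProd _ _).symm
  convert h using 1
  · ring
  · rw [zero_add, Finset.sum_add_distrib, add_comm]
    simp only [Finset.sum_const, Finset.card_univ, Fintype.card_fin, smul_eq_mul, mul_one]
    congr 1
    refine Finset.sum_congr rfl fun i _ => ?_
    congr 1
    omega

theorem hasSpan_torus_even_append_odd {k s : ℕ} (m : Fin k → ℕ) (n : Fin (k + s) → ℕ)
    (hm : ∀ i, 1 ≤ m i) (hn : ∀ i, 2 ≤ n i) :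
    HasSpan (torus (Fin.append (fun i : Fin (k + s) => 2 * n i) (fun i : Fin k => 2 * m i + 1)))
      (4 * k + 2 * s)
      (s + 2 * k ^ 2 + 2 * ∑ i : Fin k, (m i + n (Fin.castAdd s i)) +
        ∑ j : Fin s, n (Fin.natAdd k j) * (4 * k + 2 * ((j : ℕ) + 1) - 1)) := by
  have h := (hasSpan_cartesianProduct_even_boxProd_odd m (fun i => n (Fin.castAdd s i)) hm
    fun i => hn _).boxProd_torus_even (fun j => n (Fin.natAdd k j)) fun j => hn _
  obtain ⟨e₁⟩ := nonempty_torus_append (fun i : Fin (k + s) => 2 * n i)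
    (fun i : Fin k => 2 * m i + 1)
  have e₂ : (torus fun i : Fin (k + s) => 2 * n i) ≃g
      (torus fun i : Fin k => 2 * n (Fin.castAdd s i)).boxProd
        (torus fun j : Fin s => 2 * n (Fin.natAdd k j)) := cartesianProductAdd _
  have e₃ := cartesianProductBoxProd (fun i : Fin k => cycleGraph (2 * n (Fin.castAdd s i)))
    (fun i : Fin k => cycleGraph (2 * m i + 1))
  -- The isomorphism moves the odd cycles next to the first `k` even ones and matches them in pairs.
  have h' := h.of_iso <| e₁.trans <| (boxProdCongr e₂ .refl).trans <|
    (boxProdAssoc _ _ _).trans <| (boxProdCongr .refl (boxProdComm _ _)).trans <|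
    (boxProdAssoc _ _ _).symm.trans (boxProdCongr e₃.symm .refl)
  convert h' using 1
  have hodd : ∀ j : Fin s, 4 * k + 2 * ((j : ℕ) + 1) - 1 = 4 * k + 2 * j + 1 := fun j => by omega
  simp only [hodd]
  rw [Finset.sum_add_distrib (g := fun _ => 1), Finset.sum_const, Finset.card_univ,
    Fintype.card_fin, smul_eq_mul, mul_one]
  ring

/-- A torus with a coloring spanning `T` colors has at least `T` colors in some interval
coloring. -/
theorem HasSpan.torus_le_maxColors {k r T : ℕ} {a : Fin k → ℕ} (h : HasSpan (torus a) r T)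
    (ha : ∀ i, 0 < a i) (hr : 0 < r) :
    IsIntervalColorable (torus a) ∧ T ≤ maxColors (torus a) := by
  obtain ⟨t, ht, hTt, hc⟩ := h.exists_hasIntervalColoring hr (connected_torus a ha)
  exact ⟨⟨t, ht, hc⟩, hTt.trans ((isGreatest_maxColors _ ⟨t, ht, hc⟩).2 hc)⟩

/-! ### The hypercube and sharpness -/

section Hypercube

/-- The 4-cycle is the square of an edge. -/
def cycleGraphFourIso :
    cycleGraph (2 * 2) ≃g (⊤ : SimpleGraph Bool).boxProd (⊤ : SimpleGraph Bool) where
  -- The vertices of the 4-cycle in Gray code order.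
  toFun := ![(false, false), (true, false), (true, true), (false, true)]
  invFun x := bif x.1 then (bif x.2 then 2 else 1) else (bif x.2 then 3 else 0)
  left_inv := by decide
  right_inv := by decide
  map_rel_iff' := by
    intro u v
    rw [cycleGraph_adj', boxProd_adj, top_adj, top_adj]
    revert u v
    decide

theorem hypercube_adj_iff {d : ℕ} (x y : Fin d → Bool) :
    (hypercube d).Adj x y ↔ ∃ i, x i ≠ y i ∧ ∀ j, j ≠ i → x j = y j := by
  change Finset.card _ = 1 ↔ _
  rw [Finset.card_eq_one]
  refine exists_congr fun i => ?_
  simp only [Finset.ext_iff, Finset.mem_filter, Finset.mem_univ, true_and,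
    Finset.mem_singleton]
  refine ⟨fun h => ⟨(h i).2 rfl, fun j hj => not_not.1 ((h j).not.2 hj)⟩, fun h j => ⟨?_, ?_⟩⟩
  · exact fun hj => by_contra fun hji => hj (h.2 j hji)
  · rintro rfl
    exact h.1

theorem hypercube_eq_cartesianProduct (d : ℕ) :
    hypercube d = cartesianProduct fun _ : Fin d => (⊤ : SimpleGraph Bool) := by
  ext x y
  exact hypercube_adj_iff x y

theorem nonempty_torus_four_iso_hypercube (k : ℕ) :
    Nonempty (torus (fun _ : Fin k => 2 * 2) ≃g hypercube (2 * k)) := by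
  rw [two_mul k, hypercube_eq_cartesianProduct]
  exact ⟨(cartesianProductCongr fun _ => cycleGraphFourIso).trans
    ((cartesianProductBoxProd _ _).trans (cartesianProductAdd (W := fun _ : Fin (k + k) => Bool) fun _ => ⊤).symm)⟩

/-- The neighbor of `x` in direction `i`. -/
def flipAt {d : ℕ} (x : Fin d → Bool) (i : Fin d) : Fin d → Bool :=
  Function.update x i (!x i)

theorem hypercube_adj_flipAt {d : ℕ} (x : Fin d → Bool) (i : Fin d) :
    (hypercube d).Adj x (flipAt x i) := by
  rw [hypercube_adj_iff]
  exact ⟨i, by simp [flipAt], fun j hj => by simp [flipAt, hj]⟩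

theorem exists_eq_flipAt {d : ℕ} {x y : Fin d → Bool} (h : (hypercube d).Adj x y) :
    ∃ i, y = flipAt x i := by
  obtain ⟨i, hi, hij⟩ := (hypercube_adj_iff x y).1 h
  refine ⟨i, funext fun j => ?_⟩
  by_cases hj : j = i
  · subst hj
    have := Bool.eq_not_of_ne hi.symm
    simpa [flipAt] using this
  · simp [flipAt, hj, hij j hj]

theorem flipAt_injective {d : ℕ} (x : Fin d → Bool) : Function.Injective (flipAt x) := by
  intro i j h
  by_contra hij
  have := congrFun h i
  simp [flipAt, hij] at this

theorem hammingDist_flipAt {d e : ℕ} {x y : Fin d → Bool} {i : Fin d} (hi : x i ≠ y i)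
    (h : hammingDist x y = e + 1) : hammingDist (flipAt x i) y = e := by
  have : Finset.univ.filter (fun j => flipAt x i j ≠ y j) =
      (Finset.univ.filter fun j => x j ≠ y j).erase i := by
    ext j
    by_cases hj : j = i
    · subst hj
      simp [flipAt, Bool.eq_not_of_ne hi]
    · rw [Finset.mem_erase, Finset.mem_filter, Finset.mem_filter]
      simp [flipAt, hj]
  rw [hammingDist, this, Finset.card_erase_of_mem (by simpa using hi)]
  rw [hammingDist] at h
  omega

/-- Compare a vertex on an edge of color 1 with a vertex on an edge of color `t`. Their least colors
differ by at most the sum in `hdist`, and the interval at the second vertex has `d` colors. -/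
theorem HasIntervalColoring.hypercube_le {d t : ℕ} (h : HasIntervalColoring (hypercube d) t) :
    t ≤ d + ∑ i ∈ Finset.range d, (d - 1 - i) := by
  obtain ⟨α, hα⟩ := h
  rcases Nat.eq_zero_or_pos t with ht | ht
  · omega
  set c : (Fin d → Bool) → Fin d → ℕ := fun x i => α ⟨s(x, flipAt x i), hypercube_adj_flipAt x i⟩
    with hc
  have hinj : ∀ x, Function.Injective (c x) := by
    intro x i j hij
    by_contra hne
    refine hα.proper x _ _ (Sym2.mem_mk_left _ _) (Sym2.mem_mk_left _ _) ?_ hij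
    intro he
    exact hne (flipAt_injective x (Sym2.congr_right.1 (congrArg Subtype.val he)))
  have hspec : ∀ x, vertexSpectrum (hypercube d) α x = range (c x) := by
    intro x
    ext l
    constructor
    · rintro ⟨⟨e, he⟩, hx, rfl⟩
      obtain ⟨y, rfl⟩ := Sym2.mem_iff_exists.1 hx
      obtain ⟨i, hi⟩ : ∃ i, y = flipAt x i := exists_eq_flipAt he
      subst hi
      exact ⟨i, rfl⟩
    · rintro ⟨i, rfl⟩
      exact ⟨_, Sym2.mem_mk_left _ _, rfl⟩
  have hmemc : ∀ (x : Fin d → Bool) (e : (hypercube d).edgeSet), x ∈ (e : Sym2 _) →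
      α e ∈ range (c x) := fun x e hx => hspec x ▸ ⟨e, hx, rfl⟩
  have hint : ∀ x, ∃ a, ∀ l ∈ range (c x), a ≤ l ∧ l < a + d := by
    intro x
    obtain ⟨a, b, hab⟩ := hα.interval x
    rw [hspec] at hab
    have hcard : (range (c x)).ncard = d := by
      rw [← image_univ, ncard_image_of_injective _ (hinj x), ncard_univ, Nat.card_fin]
    rw [hab, ← Finset.coe_Icc, ncard_coe_finset, Nat.card_Icc] at hcard
    refine ⟨a, fun l hl => ?_⟩
    rw [hab, Set.mem_Icc] at hl
    omega
  choose a ha using hint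
  have hdist : ∀ e x y, hammingDist x y = e →
      a y ≤ a x + ∑ i ∈ Finset.range e, (d - 1 - i) := by
    intro e
    induction e with
    | zero =>
      intro x y hxy
      rw [hammingDist_eq_zero.1 hxy]
      simp
    | succ e ih =>
      intro x y hxy
      -- The `e + 1` directions towards `y` have distinct colors below `a x + d`, so the smallest is
      -- at most `a x + (d - 1 - e)`. Being also a color at `flipAt x i`, it bounds the least color
      -- there.
      obtain ⟨i, hi, hle⟩ : ∃ i, x i ≠ y i ∧ c x i ≤ a x + (d - 1 - e) := by
        by_contra! hno
        have hsub : (Finset.univ.filter fun i => x i ≠ y i).image (c x) ⊆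
            Finset.Ioo (a x + (d - 1 - e)) (a x + d) := by
          intro l hl
          obtain ⟨i, hi, rfl⟩ := Finset.mem_image.1 hl
          exact Finset.mem_Ioo.2 ⟨hno i (by simpa using hi), (ha x _ ⟨i, rfl⟩).2⟩
        have hcard := Finset.card_le_card hsub
        rw [Finset.card_image_of_injective _ (hinj x), Nat.card_Ioo] at hcard
        rw [hammingDist] at hxy
        omega
      have h1 := ih _ _ (hammingDist_flipAt hi hxy)
      have h2 := (ha (flipAt x i) _ (hmemc (flipAt x i) ⟨s(x, flipAt x i), hypercube_adj_flipAt x i⟩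
        (Sym2.mem_mk_right _ _))).1
      rw [Finset.sum_range_succ]
      simp only [hc] at hle
      omega
  have hone : 1 ∈ range α := by rw [hα.range_eq]; exact ⟨le_rfl, ht⟩
  have hmax : t ∈ range α := by rw [hα.range_eq]; exact ⟨ht, le_rfl⟩
  obtain ⟨e, he⟩ := hone
  obtain ⟨f, hf⟩ := hmax
  obtain ⟨x, hx⟩ : ∃ x, x ∈ e.1 := ⟨_, Sym2.out_fst_mem e.1⟩
  obtain ⟨y, hy⟩ : ∃ y, y ∈ f.1 := ⟨_, Sym2.out_fst_mem f.1⟩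
  have h1 := (ha x _ (hmemc x e hx)).1
  have h2 := (ha y _ (hmemc y f hy)).2
  have h3 := hdist _ x y rfl
  have h4 : hammingDist x y ≤ d := by simpa using hammingDist_le_card_fintype (x := x) (y := y)
  have h5 := Finset.sum_le_sum_of_subset (f := fun i => d - 1 - i)
    (Finset.range_subset_range.2 h4)
  omega

theorem maxColors_hypercube_le (d : ℕ) : 2 * maxColors (hypercube d) ≤ d * (d + 1) := by
  have hle : maxColors (hypercube d) ≤ d + ∑ i ∈ Finset.range d, (d - 1 - i) :=
    csSup_le' fun t ht => ht.hypercube_le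
  rw [Finset.sum_range_reflect (fun i => i) d] at hle
  have := Finset.sum_range_id_mul_two d
  cases d with
  | zero => simpa using hle
  | succ d =>
    simp only [Nat.add_sub_cancel] at this
    nlinarith

end Hypercube

theorem sum_two_mul_odd (k : ℕ) :
    k + ∑ i : Fin k, 2 * (2 * ((i : ℕ) + 1) - 1) = 2 * k ^ 2 + k := by
  rw [Fin.sum_univ_eq_sum_range (fun i => 2 * (2 * (i + 1) - 1)) k]
  induction k with
  | zero => rfl
  | succ k ih =>
    rw [Finset.sum_range_succ, show 2 * (k + 1) - 1 = 2 * k + 1 by omega]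
    linarith

end IntervalColoring

theorem mainTheorem4 :
    -- Part 1
    (∀ (k : ℕ) (n : Fin k → ℕ), 1 ≤ k → (∀ i, 2 ≤ n i) → Monotone n →
      IntervalColoring.IsIntervalColorable (IntervalColoring.torus fun i => 2 * n i) ∧
      k + ∑ i : Fin k, n i * (2 * ((i : ℕ) + 1) - 1) ≤
        IntervalColoring.maxColors (IntervalColoring.torus fun i => 2 * n i)) ∧
    -- Part 2
    (∀ (k s : ℕ) (m : Fin k → ℕ) (n : Fin (k + s) → ℕ), 1 ≤ k →
      (∀ i, 1 ≤ m i) → Monotone m → (∀ i, 2 ≤ n i) → Monotone n →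
      IntervalColoring.IsIntervalColorable (IntervalColoring.torus
        (Fin.append (fun i : Fin (k + s) => 2 * n i) (fun i : Fin k => 2 * m i + 1))) ∧
      s + 2 * k ^ 2 + 2 * ∑ i : Fin k, (m i + n (Fin.castAdd s i)) +
          ∑ j : Fin s, n (Fin.natAdd k j) * (4 * k + 2 * ((j : ℕ) + 1) - 1) ≤
        IntervalColoring.maxColors (IntervalColoring.torus
          (Fin.append (fun i : Fin (k + s) => 2 * n i) (fun i : Fin k => 2 * m i + 1)))) ∧
    -- Sharpness of Part 1: equality holds for `n₁ = ⋯ = nₖ = 2`, where the torus is `Q_{2k}`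
    (∀ k : ℕ, 1 ≤ k →
      Nonempty (IntervalColoring.torus (fun _ : Fin k => 2 * 2) ≃g
        IntervalColoring.hypercube (2 * k)) ∧
      IntervalColoring.maxColors (IntervalColoring.torus (fun _ : Fin k => 2 * 2)) =
        k + ∑ i : Fin k, 2 * (2 * ((i : ℕ) + 1) - 1) ∧
      IntervalColoring.maxColors (IntervalColoring.hypercube (2 * k)) = 2 * k ^ 2 + k) := by
  refine ⟨fun k n hk hn _ => ?_, fun k s m n hk hm _ hn _ => ?_, fun k hk => ?_⟩
  · exact (IntervalColoring.hasSpan_torus_even n hn).torus_le_maxColors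
      (fun i => by have := hn i; omega) (by omega)
  · refine (IntervalColoring.hasSpan_torus_even_append_odd m n hm hn).torus_le_maxColors
      (fun i => ?_) (by omega)
    refine Fin.addCases (fun i => ?_) (fun i => ?_) i
    · have := hn i
      simp only [Fin.append_left]
      omega
    · simp
  · obtain ⟨e⟩ := IntervalColoring.nonempty_torus_four_iso_hypercube k
    have hlow := ((IntervalColoring.hasSpan_torus_even (fun _ : Fin k => 2) fun _ => le_rfl).torus_le_maxColors
      (fun _ => by norm_num) (by omega)).2
    have hup := IntervalColoring.maxColors_hypercube_le (2 * k)
    have heq := IntervalColoring.maxColors_congr e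
    rw [IntervalColoring.sum_two_mul_odd] at hlow ⊢
    rw [heq] at hlow ⊢
    -- The torus construction and the cube bound with `d = 2 * k` meet at `2 * k ^ 2 + k`.
    have : IntervalColoring.maxColors (IntervalColoring.hypercube (2 * k)) = 2 * k ^ 2 + k := by
      nlinarith
    exact ⟨⟨e⟩, this, this⟩
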